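/- Let $k$ be an algebraically closed field of characteristic $0$, let $\mathbf F$ be a finite field, and let $0\le r\le n$ be integers. Let $\mathfrak M_n$ be the multiplicative monoid of all $n\times n$ matrices over $\mathbf F$, $k[\mathfrak M_n]$ its monoid algebra, and $\mathfrak G_r=\mathrm{GL}_r(\mathbf F)$. For an irreducible representation $\pi\colon \mathfrak G_r\to \mathbf{GL}(V)$ over $k$, let $U_1,\dots,U_N$ be the $r$-dimensional subspaces of $\mathbf F^n$, choose isomorphisms $f_i\colon \mathbf F^r\to U_i$, and let $L_n(\pi)$ be the left $k[\mathfrak M_n]$-module $V\otimes_k k^N$ on which $[m]$, for $m\in\mathfrak M_n$, acts by $\sum_{(i,j)\,:\,m(U_i)=U_j}\pi(f_j^{-1}\,m\,f_i)\otimes E_{j,i}$, where $E_{j,i}\in \mathrm M_N(k)$ is the elementary matrix. (These are the simple $k[\mathfrak M_n]$-modules.) For a left $k[\mathfrak M_n]$-module $M$, regard the $k$-linear dual $M^*=\mathrm{Hom}_k(M,k)$ as a left $k[\mathfrak M_n]$-module through the anti-involution $a\mapsto a^t$ of $k[\mathfrak M_n]$ given by $[x]\mapsto[x^t]$ (matrix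 transpose), that is, $(a\varphi)(v)=\varphi(a^t v)$. Then $L_n(\pi)$ is self-dual: for every such $\pi$ and every choice of the $f_i$, there is an isomorphism of left $k[\mathfrak M_n]$-modules $L_n(\pi)^*\cong L_n(\pi)$. -/

import Mathlib

namespace MatrixMonoid

section Dual

variable (k F : Type*) [Field k] [Field F] (n : ℕ)

/-- The monoid algebra `k[M_n]` of the multiplicative monoid of all `n × n` matrices over `F`. -/
abbrev Alg : Type _ := MonoidAlgebra k (Matrix (Fin n) (Fin n) F)

/-- The anti-involution of `k[M_n]` induced by the transpose of matrices, `[x] ↦ [xᵗ]`, written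
as an algebra homomorphism to the opposite algebra. -/
noncomputable def transposeAnti : Alg k F n →ₐ[k] (Alg k F n)ᵐᵒᵖ :=
  MonoidAlgebra.lift k (Alg k F n)ᵐᵒᵖ (Matrix (Fin n) (Fin n) F)
    { toFun := fun x => MulOpposite.op (MonoidAlgebra.of k _ x.transpose)
      map_one' := by simp [MonoidAlgebra.one_def]
      map_mul' := fun x y => by
        rw [Matrix.transpose_mul, map_mul, MulOpposite.op_mul] }

theorem transposeAnti_of (x : Matrix (Fin n) (Fin n) F) :
    transposeAnti k F n (MonoidAlgebra.of k _ x) =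
      MulOpposite.op (MonoidAlgebra.of k _ x.transpose) := by
  simp [transposeAnti]

/-- The `k`-linear dual `M^*` of a left `k[M_n]`-module `M`, as a type of its own: it carries
the left `k[M_n]`-module structure obtained from the natural right one via transpose. -/
def TransposeDual (M : Type*) [AddCommGroup M] [Module k M] [Module (Alg k F n) M]
    [IsScalarTower k (Alg k F n) M] : Type _ :=
  Module.Dual k M

variable (M : Type*) [AddCommGroup M] [Module k M] [Module (Alg k F n) M]
  [IsScalarTower k (Alg k F n) M]

noncomputable instance : AddCommGroup (TransposeDual k F n M) :=
  inferInstanceAs (AddCommGroup (Module.Dual k M))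

noncomputable instance : Module k (TransposeDual k F n M) :=
  inferInstanceAs (Module k (Module.Dual k M))

/-- The identity map from the transpose dual to the linear dual. -/
def TransposeDual.toDual : TransposeDual k F n M ≃ₗ[k] Module.Dual k M :=
  LinearEquiv.refl k (Module.Dual k M)

/-- The action `(a • φ)(v) = φ (aᵗ • v)`, where `aᵗ` is the image of `a` under the
anti-involution. -/
noncomputable instance : Module (Alg k F n) (TransposeDual k F n M) where
  smul a φ := (TransposeDual.toDual k F n M).symm
    ((TransposeDual.toDual k F n M φ).comp
      (Algebra.lsmul k k M (transposeAnti k F n a).unop))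
  one_smul φ := by
    refine LinearMap.ext fun v => ?_
    change TransposeDual.toDual k F n M φ ((transposeAnti k F n 1).unop • v) = _
    rw [map_one, MulOpposite.unop_one, one_smul]
    rfl
  mul_smul a b φ := by
    refine LinearMap.ext fun v => ?_
    change TransposeDual.toDual k F n M φ ((transposeAnti k F n (a * b)).unop • v) =
      TransposeDual.toDual k F n M φ
        ((transposeAnti k F n b).unop • (transposeAnti k F n a).unop • v)
    rw [map_mul, MulOpposite.unop_mul, mul_smul]
  smul_zero a := by
    refine LinearMap.ext fun v => ?_
    rfl
  smul_add a φ ψ := by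
    refine LinearMap.ext fun v => ?_
    rfl
  add_smul a b φ := by
    refine LinearMap.ext fun v => ?_
    change TransposeDual.toDual k F n M φ ((transposeAnti k F n (a + b)).unop • v) =
      TransposeDual.toDual k F n M φ ((transposeAnti k F n a).unop • v) +
      TransposeDual.toDual k F n M φ ((transposeAnti k F n b).unop • v)
    rw [map_add, MulOpposite.unop_add, add_smul, map_add]
  zero_smul φ := by
    refine LinearMap.ext fun v => ?_
    change TransposeDual.toDual k F n M φ ((transposeAnti k F n 0).unop • v) = 0
    rw [map_zero, MulOpposite.unop_zero, zero_smul, map_zero]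

theorem TransposeDual.smul_apply (a : Alg k F n) (φ : TransposeDual k F n M) (v : M) :
    TransposeDual.toDual k F n M (a • φ) v =
      TransposeDual.toDual k F n M φ ((transposeAnti k F n a).unop • v) :=
  rfl

end Dual

section Simple

variable (F : Type*) [Field F] (n r : ℕ)

/-- The `r`-dimensional subspaces of `F^n`. -/
def Gr : Type _ := {U : Submodule F (Fin n → F) // Module.finrank F U = r}

/-- A choice, for every `r`-dimensional subspace `U` of `F^n`, of an isomorphism `F^r ≃ U`. -/
abbrev Frames : Type _ := ∀ U : Gr F n r, (Fin r → F) ≃ₗ[F] U.1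

variable {F n r}

/-- The image `m(U)` of a subspace `U` of `F^n` under a matrix `m`. -/
def image (m : Matrix (Fin n) (Fin n) F) (U : Submodule F (Fin n → F)) :
    Submodule F (Fin n → F) :=
  U.map m.mulVecLin

theorem image_one (U : Submodule F (Fin n → F)) : image 1 U = U := by
  simp [image]

theorem image_mul (a b : Matrix (Fin n) (Fin n) F) (U : Submodule F (Fin n → F)) :
    image (a * b) U = image a (image b U) := by
  simp [image, Matrix.mulVecLin_mul, Submodule.map_comp]

/-- If `m(U) = W` with `U`, `W` both of dimension `r`, the isomorphism `m|_U : U ≃ W`. -/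
noncomputable def restrictIso (m : Matrix (Fin n) (Fin n) F) (U W : Gr F n r)
    (h : image m U.1 = W.1) : U.1 ≃ₗ[F] W.1 :=
  have hm : ∀ x ∈ U.1, m.mulVecLin x ∈ W.1 := fun _ hx => h ▸ Submodule.mem_map_of_mem hx
  have hs : Function.Surjective (m.mulVecLin.restrict hm) := by
    rintro ⟨y, hy⟩
    rw [← h] at hy
    obtain ⟨x, hx, rfl⟩ := hy
    exact ⟨⟨x, hx⟩, rfl⟩
  LinearEquiv.ofBijective (m.mulVecLin.restrict hm)
    ⟨(LinearMap.injective_iff_surjective_of_finrank_eq_finrank (U.2.trans W.2.symm)).2 hs, hs⟩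

theorem restrictIso_apply (m : Matrix (Fin n) (Fin n) F) (U W : Gr F n r)
    (h : image m U.1 = W.1) (x : U.1) :
    (restrictIso m U W h x : Fin n → F) = m.mulVec x :=
  rfl

/-- For `m(U) = W`, the automorphism `f_W⁻¹ ∘ m|_U ∘ f_U` of `F^r`, as an element of `GL_r(F)`. -/
noncomputable def transition (f : Frames F n r) (m : Matrix (Fin n) (Fin n) F) (U W : Gr F n r)
    (h : image m U.1 = W.1) : GL (Fin r) F :=
  Matrix.GeneralLinearGroup.toLin.symm
    ((LinearMap.GeneralLinearGroup.generalLinearEquiv F (Fin r → F)).symm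
      (f U ≪≫ₗ restrictIso m U W h ≪≫ₗ (f W).symm))

theorem transition_one (f : Frames F n r) (U : Gr F n r) (h : image 1 U.1 = U.1) :
    transition f 1 U U h = 1 := by
  have : f U ≪≫ₗ restrictIso 1 U U h ≪≫ₗ (f U).symm = 1 := by
    refine LinearEquiv.ext fun x => ?_
    have : restrictIso 1 U U h (f U x) = f U x := Subtype.ext (by simp [restrictIso_apply])
    simp [this]
  rw [transition, this, map_one, map_one]

theorem transition_mul (f : Frames F n r) (a b : Matrix (Fin n) (Fin n) F) (U W X : Gr F n r)
    (hb : image b U.1 = W.1) (ha : image a W.1 = X.1) (hab : image (a * b) U.1 = X.1) :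
    transition f (a * b) U X hab = transition f a W X ha * transition f b U W hb := by
  rw [transition, transition, transition, ← map_mul, ← map_mul]
  congr 2
  refine LinearEquiv.ext fun x => ?_
  have : restrictIso (a * b) U X hab (f U x) =
      restrictIso a W X ha (restrictIso b U W hb (f U x)) :=
    Subtype.ext (by simp [restrictIso_apply])
  simp [this]

variable {k V : Type*} [Field k] [AddCommGroup V] [Module k V]

open Classical in
/-- The operator by which `[m]` acts on `V ⊗ k^N = ⨁_U V`, the sum being over the `N` subspaces
`U` of `F^n` of dimension `r`: the copy of `V` at `U` is carried to the copy at `m(U)` by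
`π (f_{m(U)}⁻¹ ∘ m ∘ f_U)` if `m(U)` has dimension `r`, and to `0` otherwise. -/
noncomputable def action (f : Frames F n r) (π : Representation k (GL (Fin r) F) V)
    (m : Matrix (Fin n) (Fin n) F) : (Gr F n r →₀ V) →ₗ[k] (Gr F n r →₀ V) :=
  Finsupp.lsum k fun U : Gr F n r =>
    if h : Module.finrank F (image m U.1) = r then
      (Finsupp.lsingle ⟨image m U.1, h⟩).comp (π (transition f m U ⟨image m U.1, h⟩ rfl))
    else 0

theorem action_single (f : Frames F n r) (π : Representation k (GL (Fin r) F) V)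
    (m : Matrix (Fin n) (Fin n) F) (U W : Gr F n r) (h : image m U.1 = W.1) (v : V) :
    action f π m (Finsupp.single U v) = Finsupp.single W (π (transition f m U W h) v) := by
  obtain ⟨W, hW⟩ := W
  obtain rfl : image m U.1 = W := h
  simp only [action, Finsupp.lsum_single, dif_pos hW, LinearMap.comp_apply]
  rfl

theorem action_single_of_ne (f : Frames F n r) (π : Representation k (GL (Fin r) F) V)
    (m : Matrix (Fin n) (Fin n) F) (U : Gr F n r) (h : Module.finrank F (image m U.1) ≠ r)
    (v : V) : action f π m (Finsupp.single U v) = 0 := by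
  simp [action, h]

/-- The representation of the monoid `M_n` on `V ⊗ k^N` attached to the representation `π` of
`GL_r(F)` on `V` (and to the chosen isomorphisms `f`). -/
noncomputable def simpleRep (f : Frames F n r) (π : Representation k (GL (Fin r) F) V) :
    Representation k (Matrix (Fin n) (Fin n) F) (Gr F n r →₀ V) where
  toFun := action f π
  map_one' := by
    refine Finsupp.lhom_ext fun U v => ?_
    rw [action_single f π 1 U U (image_one U.1), transition_one]
    simp
  map_mul' a b := by
    refine Finsupp.lhom_ext fun U v => ?_
    rw [Module.End.mul_apply]
    by_cases hb : Module.finrank F (image b U.1) = r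
    · rw [action_single f π b U ⟨_, hb⟩ rfl]
      by_cases ha : Module.finrank F (image a (image b U.1)) = r
      · rw [action_single f π a ⟨_, hb⟩ ⟨_, ha⟩ rfl,
          action_single f π (a * b) U ⟨_, ha⟩ (image_mul a b U.1),
          transition_mul f a b U ⟨_, hb⟩ ⟨_, ha⟩ rfl rfl (image_mul a b U.1), map_mul,
          Module.End.mul_apply]
      · rw [action_single_of_ne f π a ⟨_, hb⟩ ha,
          action_single_of_ne f π (a * b) U (by rwa [image_mul])]
    · have hab : Module.finrank F (image (a * b) U.1) ≠ r := by
        rw [image_mul]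
        intro hr
        have h1 : Module.finrank F (image a (image b U.1)) ≤ Module.finrank F (image b U.1) :=
          Submodule.finrank_map_le _ _
        have h2 : Module.finrank F (image b U.1) ≤ Module.finrank F U.1 :=
          Submodule.finrank_map_le _ _
        have h3 := U.2
        omega
      rw [action_single_of_ne f π b U hb, map_zero, action_single_of_ne f π (a * b) U hab]

/-- The left `k[M_n]`-module `L_n(π)`. -/
abbrev L (f : Frames F n r) (π : Representation k (GL (Fin r) F) V) : Type _ :=
  (simpleRep f π).asModule

end Simple

end MatrixMonoid

/-! It suffices to find a nondegenerate bilinear form on `L f π` for which the adjoint of `[m]` is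
`[mᵗ]`.

On `V` such a form `β` exists because every square matrix is similar to its transpose: `π` and its
dual twisted by transpose then have the same character, hence are isomorphic. Similarity to the
transpose comes from `F[X]/(p)` being a Frobenius algebra.

Regard each `f_U` as an `n × r` matrix and let `π°` be `π` extended by zero to singular matrices.
The form on `⨁_U V` is `(x, w at U) ↦ β (∑_W π°(f_Uᵗ f_W) x_W) w`. The adjunction is formal, since
`m f_U = f_{mU} g` with `g` the transition matrix.

The substance is nondegeneracy: if `∑_U π°(l f_U) x_U = 0` for every `r × n` matrix `l`, then `x =
0`. Pairing with a functional on `V` turns this into a statement about scalar functions on `n × r`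
matrices: if the sum over the right inverses of each `a` vanishes, so does the function at every
matrix of rank `r`. This follows from `nondegenerateBelow`: for each `s`, the Fourier kernel
`ψ(tr(gᵗ h))`, restricted to matrices of rank less than `s`, is nondegenerate. The proof is by
induction on `s`, for all matrix sizes at once. -/

namespace MatrixMonoid

/-! ### Similarity of a matrix and its transpose -/

section TransposeConjugate

open Polynomial

/-- The algebra `F[X]/(f)` is a Frobenius algebra. -/
theorem exists_frobenius_functional {F : Type*} [Field F] {f : F[X]} (hf : f.Monic) :
    ∃ l : (F[X] ⧸ Ideal.span {f}) →ₗ[F] F, ∀ a, (∀ b, l (a * b) = 0) → a = 0 := by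
  let l₀ : F[X] →ₗ[F] F := (lcoeff F (f.natDegree - 1)).comp (modByMonicHom f)
  have hl₀ : (Submodule.restrictScalars F (Ideal.span {f})) ≤ LinearMap.ker l₀ := by
    intro a ha
    rw [Submodule.restrictScalars_mem, Ideal.mem_span_singleton] at ha
    have h0 : a %ₘ f = 0 := (modByMonic_eq_zero_iff_dvd hf).2 ha
    simp [l₀, h0]
  refine ⟨(Submodule.liftQ _ l₀ hl₀).comp
    (Submodule.Quotient.restrictScalarsEquiv F (Ideal.span {f})).symm.toLinearMap, fun a ha => ?_⟩
  obtain ⟨a, rfl⟩ := Ideal.Quotient.mk_surjective a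
  have key : ∀ b : F[X], (a * b %ₘ f).coeff (f.natDegree - 1) = 0 := fun b =>
    ha (Ideal.Quotient.mk _ b)
  rw [Ideal.Quotient.eq_zero_iff_mem, Ideal.mem_span_singleton, ← modByMonic_eq_zero_iff_dvd hf]
  by_contra hne
  set c := a %ₘ f with hc
  have hd : c.natDegree < f.natDegree := by
    refine natDegree_modByMonic_lt _ hf ?_
    rintro rfl
    exact hne (by rw [hc, modByMonic_one])
  -- The functional reads the coefficient of degree `deg f - 1` of the remainder; this power of `X`
  -- moves the leading term of `c` exactly there, with no further reduction modulo `f`.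
  have h1 : a * X ^ (f.natDegree - 1 - c.natDegree) %ₘ f =
      c * X ^ (f.natDegree - 1 - c.natDegree) := by
    have : (a * X ^ (f.natDegree - 1 - c.natDegree)) %ₘ f =
        (c * X ^ (f.natDegree - 1 - c.natDegree)) %ₘ f := by
      refine modByMonic_eq_of_dvd_sub hf ⟨(a /ₘ f) * X ^ (f.natDegree - 1 - c.natDegree), ?_⟩
      rw [← sub_mul, ← mul_assoc]
      congr 1
      rw [sub_eq_iff_eq_add, add_comm]
      exact (modByMonic_add_div a f).symm
    rw [this, (modByMonic_eq_self_iff hf)]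
    refine degree_lt_degree ?_
    rw [natDegree_mul_X_pow _ hne]
    omega
  have h2 := key (X ^ (f.natDegree - 1 - c.natDegree))
  rw [h1, coeff_mul_X_pow', if_pos (by omega),
    show f.natDegree - 1 - (f.natDegree - 1 - c.natDegree) = c.natDegree by omega] at h2
  exact hne (leadingCoeff_eq_zero.1 h2)

/-- A finitely generated torsion module over `F[X]` carries a nondegenerate bilinear form for
which multiplication by `X` is self-adjoint. -/
theorem exists_selfAdjoint_form {F M : Type*} [Field F] [AddCommGroup M] [Module F M]
    [Module F[X] M] [IsScalarTower F F[X] M] [Module.Finite F[X] M]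
    (hM : Module.IsTorsion F[X] M) :
    ∃ B : M →ₗ[F] M →ₗ[F] F, (∀ x y, B ((X : F[X]) • x) y = B x ((X : F[X]) • y)) ∧
      ∀ x, (∀ y, B x y = 0) → x = 0 := by
  classical
  obtain ⟨ι, _, p, hp, e, ⟨φ⟩⟩ := Module.equiv_directSum_of_isTorsion hM
  have hl : ∀ i, ∃ l : (F[X] ⧸ Ideal.span {p i ^ e i}) →ₗ[F] F,
      ∀ a, (∀ b, l (a * b) = 0) → a = 0 := by
    intro i
    have h0 : p i ^ e i ≠ 0 := pow_ne_zero _ (hp i).ne_zero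
    have : Ideal.span {p i ^ e i} = Ideal.span {normalize (p i ^ e i)} :=
      (Ideal.span_singleton_eq_span_singleton.2 (associated_normalize _))
    rw [this]
    exact exists_frobenius_functional (monic_normalize h0)
  choose l hl using hl
  let c : ∀ i, M →ₗ[F] (F[X] ⧸ Ideal.span {p i ^ e i}) := fun i =>
    ((DirectSum.component F[X] ι _ i).comp φ.toLinearMap).restrictScalars F
  have hc : ∀ i x, c i ((X : F[X]) • x) = (X : F[X]) • c i x := fun i x =>
    ((DirectSum.component F[X] ι _ i).comp φ.toLinearMap).map_smul _ _
  -- The orthogonal sum of the forms `(a, b) ↦ l i (a * b)` on the cyclic summands. Nondegeneracy is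
  -- tested on vectors lying in a single summand.
  refine ⟨∑ i, ((LinearMap.mul F (F[X] ⧸ Ideal.span {p i ^ e i})).compr₂ (l i)).compl₁₂ (c i) (c i),
    fun x y => ?_, fun x hx => ?_⟩
  · simp only [LinearMap.sum_apply, LinearMap.compl₁₂_apply, LinearMap.compr₂_apply, hc,
      LinearMap.mul_apply']
    exact Finset.sum_congr rfl fun i _ => by rw [smul_mul_assoc, mul_smul_comm]
  · apply φ.injective
    rw [map_zero]
    refine DirectSum.ext_component F[X] fun i => ?_
    rw [map_zero]
    refine hl i (c i x) fun b => ?_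
    have := hx (φ.symm (DirectSum.lof F[X] ι (fun i => F[X] ⧸ Ideal.span {p i ^ e i}) i b))
    rw [LinearMap.sum_apply, LinearMap.sum_apply, Finset.sum_eq_single i] at this
    · simpa [c, DirectSum.component.lof_self] using this
    · intro j _ hj
      have : c j (φ.symm (DirectSum.lof F[X] ι (fun i => F[X] ⧸ Ideal.span {p i ^ e i}) i b)) =
          0 := by
        simp only [c, LinearMap.restrictScalars_apply, LinearMap.comp_apply,
          LinearEquiv.coe_coe, LinearEquiv.apply_symm_apply]
        rw [DirectSum.component.of, dif_neg hj.symm]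
      simp [this]
    · simp

/-- Every square matrix over a field is similar to its transpose. -/
theorem exists_conj_eq_transpose {F : Type*} [Field F] {r : ℕ} (A : Matrix (Fin r) (Fin r) F) :
    ∃ P : GL (Fin r) F, (P : Matrix (Fin r) (Fin r) F) * A = A.transpose * P := by
  obtain ⟨B, hB, hnd⟩ := exists_selfAdjoint_form
    (Module.AEval.isTorsion_of_finiteDimensional F (Fin r → F) (Matrix.toLin' A))
  let o := Module.AEval.of F (Fin r → F) (Matrix.toLin' A)
  let C : (Fin r → F) →ₗ[F] (Fin r → F) →ₗ[F] F := B.compl₁₂ o.toLinearMap o.toLinearMap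
  have hC : ∀ x y, C (A.mulVec x) y = C x (A.mulVec y) := by
    intro x y
    have := hB (o x) (o y)
    rwa [Module.AEval.X_smul_of, Module.AEval.X_smul_of] at this
  have hCn : C.SeparatingLeft := by
    intro x hx
    have := hnd (o x) fun y => by simpa [C] using hx (o.symm y)
    simpa using this
  have hdet : (LinearMap.toMatrix₂' F C).det ≠ 0 := by
    rwa [← LinearMap.separatingLeft_toLinearMap₂'_iff_det_ne_zero,
      Matrix.toLinearMap₂'_toMatrix']
  refine ⟨Matrix.GeneralLinearGroup.mkOfDetNeZero _ hdet, ?_⟩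
  -- For the Gram matrix `P` of `C`, self-adjointness of `A` reads `Aᵗ P = P A`.
  have h := congrArg (LinearMap.toMatrix₂' F)
    (show C.comp (Matrix.toLin' A) = C.compl₂ (Matrix.toLin' A) from
      LinearMap.ext₂ fun x y => hC x y)
  rw [LinearMap.toMatrix₂'_comp, LinearMap.toMatrix₂'_compl₂, LinearMap.toMatrix'_toLin'] at h
  exact h.symm

end TransposeConjugate

/-! ### An irreducible representation and its transpose dual -/

section TwistedDual

variable {k F V : Type*} [Field k] [Field F] [AddCommGroup V] [Module k V] {r : ℕ}

open Classical in
/-- The extension of a representation of `GL_r(F)` by zero to the monoid of all `r × r` matrices. -/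
noncomputable def extendZero (π : Representation k (GL (Fin r) F) V) :
    Representation k (Matrix (Fin r) (Fin r) F) V where
  toFun m := if h : IsUnit m then π h.unit else 0
  map_one' := by
    rw [dif_pos isUnit_one, ← map_one π]
    exact congrArg π (Units.ext rfl)
  map_mul' a b := by
    by_cases hab : IsUnit (a * b)
    · obtain ⟨ha, hb⟩ : IsUnit a ∧ IsUnit b := by
        simp only [Matrix.isUnit_iff_isUnit_det, IsUnit.mul_iff] at hab ⊢
        exact hab
      rw [dif_pos hab, dif_pos ha, dif_pos hb, ← map_mul]
      exact congrArg π (Units.ext rfl)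
    · rw [dif_neg hab]
      by_cases ha : IsUnit a
      · rw [dif_neg (fun hb => hab (ha.mul hb)), mul_zero]
      · rw [dif_neg ha, zero_mul]

theorem extendZero_unit (π : Representation k (GL (Fin r) F) V) (g : GL (Fin r) F) :
    extendZero π (g : Matrix (Fin r) (Fin r) F) = π g := by
  refine (dif_pos g.isUnit).trans ?_
  exact congrArg π (Units.ext rfl)

theorem extendZero_of_not_isUnit (π : Representation k (GL (Fin r) F) V)
    {m : Matrix (Fin r) (Fin r) F} (h : ¬ IsUnit m) : extendZero π m = 0 :=
  dif_neg h

/-- The linear dual of `π`, made a left representation by means of the transpose. -/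
noncomputable def transposeDualRep (π : Representation k (GL (Fin r) F) V) :
    Representation k (GL (Fin r) F) (Module.Dual k V) where
  toFun g := (extendZero π (g : Matrix (Fin r) (Fin r) F).transpose).dualMap
  map_one' := by
    rw [Units.val_one, Matrix.transpose_one, map_one]
    rfl
  map_mul' a b := by
    rw [Units.val_mul, Matrix.transpose_mul, map_mul]
    rfl

/-- Dualizing preserves traces, and `gᵗ` is conjugate to `g` inside `GL_r(F)`. -/
theorem transposeDualRep_character [FiniteDimensional k V]
    (π : Representation k (GL (Fin r) F) V) :
    (transposeDualRep π).character = π.character := by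
  ext g
  obtain ⟨P, hP⟩ := exists_conj_eq_transpose (g : Matrix (Fin r) (Fin r) F)
  have h : (g : Matrix (Fin r) (Fin r) F).transpose = ((P * g * P⁻¹ : GL (Fin r) F) :) := by
    rw [Units.val_mul, Units.val_mul, hP, mul_assoc, ← Units.val_mul, mul_inv_cancel,
      Units.val_one, mul_one]
  calc (transposeDualRep π).character g
      = LinearMap.trace k V (extendZero π (g : Matrix (Fin r) (Fin r) F).transpose) :=
        LinearMap.trace_transpose' _
    _ = π.character (P * g * P⁻¹) := by rw [h, extendZero_unit]; rfl
    _ = π.character g := π.char_conj g P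

theorem finiteDimensional_of_isIrreducible {G : Type*} [Group G] [Finite G]
    (π : Representation k G V) (hπ : π.IsIrreducible) : FiniteDimensional k V := by
  have := (Representation.irreducible_iff_isSimpleModule_asModule π).1 hπ
  have h1 : Module.Finite (MonoidAlgebra k G) π.asModule := inferInstance
  have h2 : Module.Finite k (MonoidAlgebra k G) := inferInstance
  have : Module.Finite k π.asModule := Module.Finite.trans (MonoidAlgebra k G) _
  exact Module.Finite.equiv π.asModuleEquiv

/-- An irreducible representation of `GL_r(F)` carries a nondegenerate form for which the
adjoint of `m` is its transpose. -/
theorem exists_transpose_form [IsAlgClosed k] [CharZero k] [Finite F]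
    (π : Representation k (GL (Fin r) F) V) (hπ : π.IsIrreducible) :
    ∃ β : V →ₗ[k] Module.Dual k V, Function.Injective β ∧
      ∀ m v w, β (extendZero π m v) w = β v (extendZero π m.transpose w) := by
  have := finiteDimensional_of_isIrreducible π hπ
  have : Fintype (GL (Fin r) F) := Fintype.ofFinite _
  have : Invertible (Nat.card (GL (Fin r) F) : k) :=
    invertibleOfNonzero (Nat.cast_ne_zero.2 Nat.card_pos.ne')
  -- Equal characters give `dim Hom(π, π') = dim End(π) = 1`, where `π'` is the transpose dual; a
  -- nonzero intertwiner is injective by irreducibility.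
  have h1 := Representation.card_inv_mul_sum_char_mul_char_eq_finrank π (transposeDualRep π)
  rw [transposeDualRep_character, Representation.card_inv_mul_sum_char_mul_char_eq_finrank,
    Representation.IsIrreducible.finrank_intertwiningMap_self, Nat.cast_inj] at h1
  obtain ⟨φ, hφ⟩ : ∃ φ : Representation.IntertwiningMap π (transposeDualRep π), φ ≠ 0 := by
    by_contra! h
    have : Subsingleton (Representation.IntertwiningMap π (transposeDualRep π)) :=
      ⟨fun a b => (h a).trans (h b).symm⟩
    rw [Module.finrank_zero_of_subsingleton] at h1
    exact one_ne_zero h1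
  refine ⟨φ.toLinearMap,
    (Representation.IsIrreducible.injective_or_eq_zero φ).resolve_right hφ, fun m v w => ?_⟩
  by_cases hm : IsUnit m
  · obtain ⟨g, rfl⟩ := hm
    rw [extendZero_unit]
    exact LinearMap.congr_fun (LinearMap.congr_fun (φ.isIntertwining' g) v) w
  · have hm' : ¬ IsUnit m.transpose := by rwa [Matrix.isUnit_transpose]
    simp [extendZero_of_not_isUnit π hm, extendZero_of_not_isUnit π hm']

end TwistedDual

/-! ### Bases of subspaces as rectangular matrices -/

section Frame

variable {F : Type*} [Field F] {n r s : ℕ}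

/-- The `n × s` matrix whose columns are the basis of `U` given by `e`. -/
noncomputable def frameMatrix {U : Submodule F (Fin n → F)} (e : (Fin s → F) ≃ₗ[F] U) :
    Matrix (Fin n) (Fin s) F :=
  LinearMap.toMatrix' (U.subtype ∘ₗ e.toLinearMap)

theorem frameMatrix_mulVec {U : Submodule F (Fin n → F)} (e : (Fin s → F) ≃ₗ[F] U)
    (x : Fin s → F) : (frameMatrix e).mulVec x = e x := by
  rw [frameMatrix, ← Matrix.toLin'_apply, Matrix.toLin'_toMatrix']
  rfl

theorem range_frameMatrix {U : Submodule F (Fin n → F)} (e : (Fin s → F) ≃ₗ[F] U) :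
    LinearMap.range (frameMatrix e).mulVecLin = U := by
  ext y
  constructor
  · rintro ⟨x, rfl⟩
    rw [Matrix.mulVecLin_apply, frameMatrix_mulVec]
    exact (e x).2
  · intro hy
    exact ⟨e.symm ⟨y, hy⟩, by rw [Matrix.mulVecLin_apply, frameMatrix_mulVec]; simp⟩

theorem exists_mul_frameMatrix_eq_one {U : Submodule F (Fin n → F)} (e : (Fin s → F) ≃ₗ[F] U) :
    ∃ l : Matrix (Fin s) (Fin n) F, l * frameMatrix e = 1 := by
  obtain ⟨g, hg⟩ := LinearMap.exists_leftInverse_of_injective (U.subtype ∘ₗ e.toLinearMap)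
    (LinearMap.ker_eq_bot.2 (U.injective_subtype.comp e.injective))
  refine ⟨LinearMap.toMatrix' g, ?_⟩
  rw [frameMatrix, ← LinearMap.toMatrix'_comp, hg, LinearMap.toMatrix'_id]

theorem exists_eq_mul_of_range_le {u : Matrix (Fin n) (Fin s) F} {h : Matrix (Fin n) (Fin r) F}
    (hle : LinearMap.range h.mulVecLin ≤ LinearMap.range u.mulVecLin) :
    ∃ v : Matrix (Fin s) (Fin r) F, h = u * v := by
  choose w hw using fun j => hle ⟨Pi.single j 1, rfl⟩
  refine ⟨(Matrix.of w).transpose, ?_⟩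
  ext i j
  have := congrFun (hw j) i
  simp only [Matrix.mulVecLin_apply, Matrix.mulVec_single_one] at this
  simp only [Matrix.mul_apply, Matrix.transpose_apply, Matrix.of_apply]
  exact this.symm

theorem isUnit_of_le_rank {g : Matrix (Fin s) (Fin s) F} (h : s ≤ g.rank) : IsUnit g := by
  rw [← Matrix.mulVec_surjective_iff_isUnit]
  have : LinearMap.range g.mulVecLin = ⊤ :=
    Submodule.eq_top_of_finrank_eq (by
      have := g.rank_le_width
      rw [Module.finrank_fin_fun]
      exact le_antisymm this h)
  exact LinearMap.range_eq_top.1 this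

end Frame

/-! ### Fourier transform on matrices and the rank filtration -/

section Fourier

variable {k F : Type*} [Field k] [Field F] [Fintype F] [DecidableEq F] {n r s : ℕ}

/-- The Fourier transform of a function on matrices, for the pairing `(g, h) ↦ tr (gᵗ h)`. -/
def fourier (ψ : AddChar F k) (x : Matrix (Fin n) (Fin r) F → k) (g : Matrix (Fin n) (Fin r) F) :
    k :=
  ∑ h, x h * ψ (g.transpose * h).trace

/-- The direct image of a function on matrices under right multiplication by `a`. -/
def rightMul (a : Matrix (Fin r) (Fin s) F) (x : Matrix (Fin n) (Fin r) F → k)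
    (g : Matrix (Fin n) (Fin s) F) : k :=
  ∑ h with h * a = g, x h

omit [DecidableEq F] in
theorem fourier_sub (ψ : AddChar F k) (x y : Matrix (Fin n) (Fin r) F → k)
    (g : Matrix (Fin n) (Fin r) F) : fourier ψ (x - y) g = fourier ψ x g - fourier ψ y g := by
  simp [fourier, sub_mul]

/-- Right multiplications by `a` and `aᵗ` are adjoint for the trace pairing, so direct image becomes
pullback. The pullback sees only matrices of rank at most `s`. -/
theorem fourier_rightMul (ψ : AddChar F k) (x : Matrix (Fin n) (Fin r) F → k)
    (a : Matrix (Fin r) (Fin s) F) (g : Matrix (Fin n) (Fin s) F) :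
    fourier ψ (rightMul a x) g = fourier ψ x (g * a.transpose) := by
  have h1 : ∀ h : Matrix (Fin n) (Fin s) F,
      (∑ h₁ : Matrix (Fin n) (Fin r) F with h₁ * a = h, x h₁) * ψ (g.transpose * h).trace =
        ∑ h₁ : Matrix (Fin n) (Fin r) F with h₁ * a = h,
          x h₁ * ψ ((g * a.transpose).transpose * h₁).trace := by
    intro h
    rw [Finset.sum_mul]
    refine Finset.sum_congr rfl fun h₁ hh => ?_
    obtain rfl := (Finset.mem_filter.1 hh).2
    rw [Matrix.transpose_mul, Matrix.transpose_transpose, ← Matrix.mul_assoc, Matrix.trace_mul_comm,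
      Matrix.mul_assoc]
  simp only [fourier, rightMul, h1]
  exact Finset.sum_fiberwise _ _ _

theorem sum_addChar_trace {ψ : AddChar F k} (hψ : ψ.IsPrimitive) {d : Matrix (Fin n) (Fin r) F}
    (hd : d ≠ 0) : ∑ g : Matrix (Fin n) (Fin r) F, ψ (g.transpose * d).trace = 0 := by
  let χ : AddChar (Matrix (Fin n) (Fin r) F) k :=
    { toFun := fun g => ψ (g.transpose * d).trace
      map_zero_eq_one' := by simp
      map_add_eq_mul' := fun a b => by
        rw [Matrix.transpose_add, Matrix.add_mul, Matrix.trace_add, AddChar.map_add_eq_mul] }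
  refine AddChar.sum_eq_zero_of_ne_one (ψ := χ) fun h1 => hd ?_
  ext i j
  by_contra hij
  refine hψ hij (DFunLike.ext _ _ fun c => ?_)
  have := DFunLike.congr_fun h1 (Matrix.single i j c)
  simpa [χ, Matrix.trace_single_mul, mul_comm] using this

/-- Fourier inversion: by orthogonality the double sum collapses to `x h₀` times the number of
matrices, which is nonzero in characteristic zero. -/
theorem eq_zero_of_fourier_eq_zero [CharZero k] {ψ : AddChar F k} (hψ : ψ.IsPrimitive)
    {x : Matrix (Fin n) (Fin r) F → k} (hx : ∀ g, fourier ψ x g = 0) : x = 0 := by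
  funext h₀
  have h1 : ∑ g, fourier ψ x g * ψ (-(g.transpose * h₀).trace) =
      ∑ h, x h * ∑ g : Matrix (Fin n) (Fin r) F, ψ (g.transpose * (h - h₀)).trace := by
    simp only [fourier, Finset.sum_mul, Finset.mul_sum]
    rw [Finset.sum_comm]
    refine Finset.sum_congr rfl fun h _ => Finset.sum_congr rfl fun g _ => ?_
    rw [mul_assoc, ← AddChar.map_add_eq_mul, Matrix.mul_sub, Matrix.trace_sub, sub_eq_add_neg]
  rw [Finset.sum_eq_zero (fun g _ => by rw [hx, zero_mul]), Finset.sum_eq_single h₀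
    (fun h _ hne => by rw [sum_addChar_trace hψ (sub_ne_zero.2 hne), mul_zero]) (by simp)] at h1
  simpa using h1

/-- The Fourier transform restricts to a nondegenerate form on functions supported on matrices of
rank less than `s`. -/
def NondegenerateBelow (ψ : AddChar F k) (s : ℕ) : Prop :=
  ∀ (n r : ℕ) (x : Matrix (Fin n) (Fin r) F → k), (∀ h, s ≤ h.rank → x h = 0) →
    (∀ g, g.rank < s → fourier ψ x g = 0) → x = 0

-- On the finite-dimensional space of functions supported in rank less than `s`, the restricted
-- transform is injective, hence surjective.
omit [DecidableEq F] in
theorem NondegenerateBelow.exists_fourier_eq {ψ : AddChar F k} (hN : NondegenerateBelow ψ s)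
    (y : Matrix (Fin n) (Fin r) F → k) :
    ∃ z : Matrix (Fin n) (Fin r) F → k, (∀ h, s ≤ h.rank → z h = 0) ∧
      ∀ g, g.rank < s → fourier ψ z g = fourier ψ y g := by
  classical
  let X := {h : Matrix (Fin n) (Fin r) F // h.rank < s}
  let ext : (X → k) → Matrix (Fin n) (Fin r) F → k :=
    fun z h => if hh : h.rank < s then z ⟨h, hh⟩ else 0
  have hext : ∀ z h, s ≤ h.rank → ext z h = 0 := fun z h hh => dif_neg (not_lt.2 hh)
  let A : (X → k) →ₗ[k] (X → k) :=
    { toFun := fun z g => fourier ψ (ext z) g.1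
      map_add' := fun z w => by
        funext g
        simp only [fourier, Pi.add_apply, ← Finset.sum_add_distrib, ← add_mul]
        refine Finset.sum_congr rfl fun h _ => ?_
        congr 1
        simp only [ext]
        split_ifs <;> simp
      map_smul' := fun c z => by
        funext g
        simp only [fourier, Pi.smul_apply, smul_eq_mul, RingHom.id_apply, Finset.mul_sum,
          ← mul_assoc]
        refine Finset.sum_congr rfl fun h _ => ?_
        congr 1
        simp only [ext]
        split_ifs <;> simp }
  have hA : Function.Injective A := by
    rw [injective_iff_map_eq_zero]
    intro z hz
    have h0 := hN n r (ext z) (hext z) fun g hg => congrFun hz ⟨g, hg⟩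
    funext g
    have := congrFun h0 g.1
    exact (dif_pos g.2).symm.trans this
  obtain ⟨z, hz⟩ := LinearMap.injective_iff_surjective.1 hA fun g => fourier ψ y g.1
  exact ⟨ext z, hext z, fun g hg => congrFun hz ⟨g, hg⟩⟩

/-- A function on `s × r` matrices whose sum over the left inverses of every `r × s` matrix
vanishes is supported on matrices of rank less than `s`. -/
theorem NondegenerateBelow.eq_zero_of_sum_left_inverses [CharZero k] {ψ : AddChar F k}
    (hψ : ψ.IsPrimitive) (hN : NondegenerateBelow ψ s) {y : Matrix (Fin s) (Fin r) F → k}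
    (hy : ∀ a : Matrix (Fin r) (Fin s) F, rightMul a y 1 = 0)
    (h : Matrix (Fin s) (Fin r) F) (hh : s ≤ h.rank) : y h = 0 := by
  -- The aim is `y = z`. Subtracting `z` kills the transform in rank less than `s` without affecting
  -- direct images at invertible matrices.
  obtain ⟨z, hz, hzy⟩ := hN.exists_fourier_eq y
  have hsupp : ∀ (a : Matrix (Fin r) (Fin s) F) g, s ≤ g.rank → rightMul a (y - z) g = 0 := by
    intro a g hg
    have h1 : rightMul a y g = 0 := by
      obtain ⟨g, rfl⟩ := isUnit_of_le_rank hg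
      rw [← hy (a * ((g⁻¹ : GL (Fin s) F) : Matrix (Fin s) (Fin s) F))]
      refine Finset.sum_congr (Finset.filter_congr fun h _ => ?_) fun _ _ => rfl
      rw [← Matrix.mul_assoc]
      exact (Units.mul_inv_eq_one).symm
    have h2 : rightMul a z g = 0 := by
      refine Finset.sum_eq_zero fun h hh => hz h ?_
      obtain rfl := (Finset.mem_filter.1 hh).2
      exact hg.trans (Matrix.rank_mul_le_left _ _)
    have : rightMul a (y - z) g = rightMul a y g - rightMul a z g := by simp [rightMul]
    rw [this, h1, h2, sub_zero]
  have hzero : ∀ a : Matrix (Fin r) (Fin s) F, rightMul a (y - z) = 0 := fun a =>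
    hN s s _ (hsupp a) fun g hg => by
      rw [fourier_rightMul, fourier_sub, hzy _ ((Matrix.rank_mul_le_left _ _).trans_lt hg),
        sub_self]
  -- Every `g` is `1 * aᵗ` with `a = gᵗ`, so the vanishing direct images determine the whole
  -- transform.
  have hyz : y - z = 0 := eq_zero_of_fourier_eq_zero hψ fun g => by
    have := fourier_rightMul ψ (y - z) g.transpose 1
    rw [hzero, Matrix.transpose_transpose, Matrix.one_mul] at this
    rw [← this]
    simp [fourier]
  rw [sub_eq_zero.1 hyz]
  exact hz h hh

/-- In the step from `s` to `s + 1`, it is enough to show that `x` vanishes in rank exactly `s`,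
since the induction hypothesis then applies to `x` itself. Matrices with a given image of dimension
`s` are the `u * v` with `u` a fixed basis of that image and `v` of rank `s`, so the question is
about `v ↦ x (u * v)`. -/
theorem nondegenerateBelow [CharZero k] {ψ : AddChar F k} (hψ : ψ.IsPrimitive) (s : ℕ) :
    NondegenerateBelow ψ s := by
  induction s with
  | zero => exact fun n r x hx _ => funext fun h => hx h (Nat.zero_le _)
  | succ s ih =>
    intro n r x hx hxg
    have hright : ∀ a : Matrix (Fin r) (Fin s) F, rightMul a x = 0 := fun a =>
      eq_zero_of_fourier_eq_zero hψ fun g => by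
        rw [fourier_rightMul]
        exact hxg _ (Nat.lt_succ_of_le ((Matrix.rank_mul_le_left _ _).trans g.rank_le_width))
    refine ih n r x (fun h₀ hh₀ => ?_) fun g hg => hxg g (hg.trans (Nat.lt_succ_self s))
    rcases hh₀.lt_or_eq with hlt | heq
    · exact hx h₀ hlt
    let e : (Fin s → F) ≃ₗ[F] LinearMap.range h₀.mulVecLin :=
      LinearEquiv.ofFinrankEq _ _ (by rw [Module.finrank_fin_fun, heq]; rfl)
    obtain ⟨l, hl⟩ := exists_mul_frameMatrix_eq_one e
    set u := frameMatrix e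
    have hfac : ∀ h : Matrix (Fin n) (Fin r) F, LinearMap.range h.mulVecLin ≤
        LinearMap.range u.mulVecLin → u * (l * h) = h := by
      intro h hle
      obtain ⟨v, rfl⟩ := exists_eq_mul_of_range_le hle
      rw [← Matrix.mul_assoc l, hl, Matrix.one_mul]
    have hu : u.rank = s := by
      rw [Matrix.rank, range_frameMatrix, heq]; rfl
    have hh : u * (l * h₀) = h₀ := hfac h₀ (range_frameMatrix e).ge
    have key : ∀ a : Matrix (Fin r) (Fin s) F,
        rightMul a (fun v : Matrix (Fin s) (Fin r) F => x (u * v)) 1 = 0 := by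
      intro a
      refine Eq.trans ?_ (congrFun (hright a) u)
      -- If `h * a = u` then the image of `h` contains that of `u`. When `x h ≠ 0` the rank of `h`
      -- is at most `s`, so the images agree and `h = u * v` with `v * a = 1`.
      refine Finset.sum_of_injOn (fun v : Matrix (Fin s) (Fin r) F => u * v) ?_ ?_ ?_ fun _ _ => rfl
      · intro v _ w _ hvw
        have := congrArg (fun w : Matrix (Fin n) (Fin r) F => l * w) hvw
        simpa only [← Matrix.mul_assoc, hl, Matrix.one_mul] using this
      · intro v hv
        have hv : v * a = 1 := by simpa using hv
        simp [Matrix.mul_assoc, hv]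
      · intro h hha hnot
        have hha : h * a = u := by simpa using hha
        by_contra hne
        have hrank : h.rank ≤ s := by
          by_contra hlt
          exact hne (hx h (not_le.1 hlt))
        have hle : LinearMap.range u.mulVecLin ≤ LinearMap.range h.mulVecLin := by
          rw [← hha, Matrix.mulVecLin_mul]
          exact LinearMap.range_comp_le_range _ _
        have hr := Submodule.eq_of_le_of_finrank_le hle (hrank.trans hu.ge)
        refine hnot ⟨l * h, ?_, hfac h hr.ge⟩
        simp [Matrix.mul_assoc, hha, hl]
    rw [← hh]
    refine ih.eq_zero_of_sum_left_inverses hψ key (l * h₀) ?_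
    have := Matrix.rank_mul_le_right u (l * h₀)
    rwa [hh, ← heq] at this

/-- The standard primitive character takes values in a cyclotomic extension of `k`, which embeds
back into the algebraically closed `k`. -/
theorem exists_primitive_addChar (k F : Type*) [Field k] [IsAlgClosed k] [CharZero k] [Field F]
    [Finite F] : ∃ ψ : AddChar F k, ψ.IsPrimitive := by
  let ψ := AddChar.FiniteField.primitiveChar F k (by
    rw [ringChar.eq_zero]
    exact (CharP.ringChar_ne_zero_of_finite F).symm)
  let i : CyclotomicField ψ.n k →ₐ[k] k :=
    have : Algebra.IsAlgebraic k (CyclotomicField ψ.n k) :=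
      inferInstanceAs (Algebra.IsAlgebraic k (Polynomial.SplittingField _))
    IsAlgClosed.lift
  refine ⟨(i : CyclotomicField ψ.n k →* k).compAddChar ψ.char,
    ψ.prim.compMulHom_of_isPrimitive (f := (i : CyclotomicField ψ.n k →* k)) i.injective⟩

/-- A function on `n × r` matrices whose sum over the right inverses of every `r × n` matrix
vanishes is supported on matrices of rank less than `r`. -/
theorem eq_zero_of_sum_right_inverses [IsAlgClosed k] [CharZero k]
    {y : Matrix (Fin n) (Fin r) F → k} (hy : ∀ a : Matrix (Fin r) (Fin n) F,
      ∑ h : Matrix (Fin n) (Fin r) F with a * h = (1 : Matrix (Fin r) (Fin r) F), y h = 0)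
    (h : Matrix (Fin n) (Fin r) F) (hh : h.rank = r) : y h = 0 := by
  obtain ⟨ψ, hψ⟩ := exists_primitive_addChar k F
  -- Transposing exchanges left and right inverses.
  refine (nondegenerateBelow hψ r).eq_zero_of_sum_left_inverses hψ
    (y := fun g => y g.transpose) (fun a => ?_) h.transpose (by rw [Matrix.rank_transpose, hh])
  rw [← hy a.transpose, rightMul]
  refine Finset.sum_equiv (Matrix.transposeAddEquiv _ _ F).toEquiv (fun g => ?_) fun _ _ => rfl
  simp only [Finset.mem_filter, Finset.mem_univ, true_and, AddEquiv.toEquiv_eq_coe,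
    AddEquiv.coe_toEquiv, Matrix.transposeAddEquiv_apply]
  rw [← Matrix.transpose_mul, Matrix.transpose_eq_one]

end Fourier

/-! ### The bilinear form on `⨁_U V` and its nondegeneracy -/

section Form

variable {k F V : Type*} [Field k] [Field F] [AddCommGroup V] [Module k V] {n r : ℕ}

theorem mul_frameMatrix (f : Frames F n r) (m : Matrix (Fin n) (Fin n) F) (U W : Gr F n r)
    (h : image m U.1 = W.1) :
    m * frameMatrix (f U) = frameMatrix (f W) *
      (transition f m U W h : Matrix (Fin r) (Fin r) F) := by
  have ht : ∀ x, (transition f m U W h : Matrix (Fin r) (Fin r) F).mulVec x =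
      (f W).symm (restrictIso m U W h (f U x)) := by
    intro x
    have : Matrix.GeneralLinearGroup.toLin (transition f m U W h) =
        (LinearMap.GeneralLinearGroup.generalLinearEquiv F (Fin r → F)).symm
          (f U ≪≫ₗ restrictIso m U W h ≪≫ₗ (f W).symm) := MulEquiv.apply_symm_apply _ _
    exact congrArg (fun g : LinearMap.GeneralLinearGroup F (Fin r → F) => g.1 x) this
  refine Matrix.ext_of_mulVec_single fun i => ?_
  rw [← Matrix.mulVec_mulVec, ← Matrix.mulVec_mulVec, ht, frameMatrix_mulVec, frameMatrix_mulVec,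
    LinearEquiv.apply_symm_apply, restrictIso_apply]

theorem not_isUnit_mul_frameMatrix (f : Frames F n r) {m : Matrix (Fin n) (Fin n) F} {U : Gr F n r}
    (h : Module.finrank F (image m U.1) ≠ r) (l : Matrix (Fin r) (Fin n) F) :
    ¬ IsUnit (l * (m * frameMatrix (f U))) := by
  intro hu
  refine h (le_antisymm ((Submodule.finrank_map_le _ _).trans U.2.le) ?_)
  have h1 := Matrix.rank_of_isUnit _ hu
  rw [Fintype.card_fin] at h1
  calc r = _ := h1.symm
    _ ≤ (m * frameMatrix (f U)).rank := Matrix.rank_mul_le_right _ _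
    _ = Module.finrank F (image m U.1) := by
      rw [Matrix.rank, Matrix.mulVecLin_mul, LinearMap.range_comp, range_frameMatrix, image]

instance [Finite F] : Finite (Gr F n r) := by
  have : Finite (Submodule F (Fin n → F)) :=
    Finite.of_injective (fun U => (U : Set (Fin n → F))) SetLike.coe_injective
  exact Subtype.finite

variable [Fintype (Gr F n r)]

/-- The operator `⨁_U V → V` attached to an `r × n` matrix `l`: on the copy of `V` at `U` it is
`π (l f_U)`, or `0` if `l f_U` is singular. -/
noncomputable def projectAlong (f : Frames F n r) (π : Representation k (GL (Fin r) F) V)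
    (l : Matrix (Fin r) (Fin n) F) : (Gr F n r →₀ V) →ₗ[k] V :=
  ∑ U, (extendZero π (l * frameMatrix (f U))).comp (Finsupp.lapply U)

theorem projectAlong_apply (f : Frames F n r) (π : Representation k (GL (Fin r) F) V)
    (l : Matrix (Fin r) (Fin n) F) (x : Gr F n r →₀ V) :
    projectAlong f π l x = ∑ U, extendZero π (l * frameMatrix (f U)) (x U) := by
  simp [projectAlong]

theorem projectAlong_single (f : Frames F n r) (π : Representation k (GL (Fin r) F) V)
    (l : Matrix (Fin r) (Fin n) F) (U : Gr F n r) (v : V) :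
    projectAlong f π l (Finsupp.single U v) = extendZero π (l * frameMatrix (f U)) v := by
  rw [projectAlong_apply, Finset.sum_eq_single U (fun W _ hW => by
    rw [Finsupp.single_eq_of_ne hW, map_zero]) (by simp), Finsupp.single_eq_same]

theorem projectAlong_mul (f : Frames F n r) (π : Representation k (GL (Fin r) F) V)
    (g : Matrix (Fin r) (Fin r) F) (l : Matrix (Fin r) (Fin n) F) (x : Gr F n r →₀ V) :
    projectAlong f π (g * l) x = extendZero π g (projectAlong f π l x) := by
  simp only [projectAlong_apply, map_sum, Matrix.mul_assoc, map_mul, Module.End.mul_apply]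

/-- If `m` preserves the dimension of `U`, use `m f_U = f_{mU} g`; otherwise `l m f_U` is singular
and both sides vanish on the copy at `U`. -/
theorem projectAlong_action (f : Frames F n r) (π : Representation k (GL (Fin r) F) V)
    (l : Matrix (Fin r) (Fin n) F) (m : Matrix (Fin n) (Fin n) F) (x : Gr F n r →₀ V) :
    projectAlong f π l (action f π m x) = projectAlong f π (l * m) x := by
  suffices h : (projectAlong f π l).comp (action f π m) = projectAlong f π (l * m) from
    LinearMap.congr_fun h x
  refine Finsupp.lhom_ext fun U v => ?_
  rw [LinearMap.comp_apply, projectAlong_single, Matrix.mul_assoc]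
  by_cases h : Module.finrank F (image m U.1) = r
  · obtain ⟨W, hW⟩ : ∃ W : Gr F n r, image m U.1 = W.1 := ⟨⟨_, h⟩, rfl⟩
    rw [action_single f π m U W hW, projectAlong_single, mul_frameMatrix f m U W hW,
      ← Matrix.mul_assoc, map_mul, extendZero_unit]
    rfl
  · rw [action_single_of_ne f π m U h, map_zero,
      extendZero_of_not_isUnit π (not_isUnit_mul_frameMatrix f h l), LinearMap.zero_apply]

theorem projectAlong_of_rank_ne (f : Frames F n r) (π : Representation k (GL (Fin r) F) V)
    {l : Matrix (Fin r) (Fin n) F} (hl : l.rank ≠ r) : projectAlong f π l = 0 := by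
  refine Finset.sum_eq_zero fun U _ => ?_
  rw [extendZero_of_not_isUnit π, LinearMap.zero_comp]
  intro hu
  have h1 := Matrix.rank_of_isUnit _ hu
  rw [Fintype.card_fin] at h1
  exact hl (le_antisymm l.rank_le_height (h1.symm.trans_le (Matrix.rank_mul_le_left _ _)))

/-- The bilinear form on `⨁_U V` built from a form `β` on `V`. -/
noncomputable def transposeForm (f : Frames F n r) (π : Representation k (GL (Fin r) F) V)
    (β : V →ₗ[k] Module.Dual k V) : (Gr F n r →₀ V) →ₗ[k] Module.Dual k (Gr F n r →₀ V) :=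
  ∑ U, (β.comp (projectAlong f π (frameMatrix (f U)).transpose)).compl₂ (Finsupp.lapply U)

theorem transposeForm_single (f : Frames F n r) (π : Representation k (GL (Fin r) F) V)
    (β : V →ₗ[k] Module.Dual k V) (x : Gr F n r →₀ V) (U : Gr F n r) (w : V) :
    transposeForm f π β x (Finsupp.single U w) =
      β (projectAlong f π (frameMatrix (f U)).transpose x) w := by
  simp only [transposeForm, LinearMap.sum_apply, LinearMap.compl₂_apply, LinearMap.comp_apply,
    Finsupp.lapply_apply]
  rw [Finset.sum_eq_single U (fun W _ hW => by
    rw [Finsupp.single_eq_of_ne hW, map_zero]) (by simp), Finsupp.single_eq_same]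

theorem transposeForm_action (f : Frames F n r) (π : Representation k (GL (Fin r) F) V)
    {β : V →ₗ[k] Module.Dual k V}
    (hβ : ∀ m v w, β (extendZero π m v) w = β v (extendZero π m.transpose w))
    (m : Matrix (Fin n) (Fin n) F) (x y : Gr F n r →₀ V) :
    transposeForm f π β (action f π m x) y =
      transposeForm f π β x (action f π m.transpose y) := by
  suffices h : transposeForm f π β (action f π m x) =
      (transposeForm f π β x).comp (action f π m.transpose) from LinearMap.congr_fun h y
  refine Finsupp.lhom_ext fun W w => ?_
  rw [LinearMap.comp_apply, transposeForm_single, projectAlong_action]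
  have hT : (frameMatrix (f W)).transpose * m = (m.transpose * frameMatrix (f W)).transpose := by
    rw [Matrix.transpose_mul, Matrix.transpose_transpose]
  rw [hT]
  by_cases h : Module.finrank F (image m.transpose W.1) = r
  · obtain ⟨X, hX⟩ : ∃ X : Gr F n r, image m.transpose W.1 = X.1 := ⟨⟨_, h⟩, rfl⟩
    rw [action_single f π _ W X hX, transposeForm_single, mul_frameMatrix f _ W X hX,
      Matrix.transpose_mul, projectAlong_mul, hβ, Matrix.transpose_transpose, extendZero_unit]
  · rw [action_single_of_ne f π _ W h, map_zero, projectAlong_of_rank_ne, LinearMap.zero_apply,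
      map_zero, LinearMap.zero_apply]
    rw [Matrix.rank_transpose, Matrix.rank, Matrix.mulVecLin_mul, LinearMap.range_comp,
      range_frameMatrix]
    exact h

/-- An element of `⨁_U V` killed by all the operators `projectAlong` is zero. -/
theorem eq_zero_of_projectAlong_eq_zero [IsAlgClosed k] [CharZero k] [Finite F]
    (f : Frames F n r) (π : Representation k (GL (Fin r) F) V) {x : Gr F n r →₀ V}
    (hx : ∀ l, projectAlong f π l x = 0) : x = 0 := by
  classical
  have : Fintype F := Fintype.ofFinite F
  have : Fintype (GL (Fin r) F) := Fintype.ofFinite _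
  ext U₀
  rw [Finsupp.zero_apply, ← Module.forall_dual_apply_eq_zero_iff k]
  intro φ
  -- A rank `r` matrix is uniquely `f_U t`, and `y` takes the value `φ (π t⁻¹ (x U))` there. Since
  -- `a f_U t = 1` means `t⁻¹ = a f_U`, its sum over the right inverses of `a` is `φ (projectAlong f
  -- π a x)`.
  let y : Matrix (Fin n) (Fin r) F → k := fun h => ∑ U, ∑ t : GL (Fin r) F,
    if frameMatrix (f U) * (t : Matrix (Fin r) (Fin r) F) = h then φ (π t⁻¹ (x U)) else 0
  have hy : ∀ a : Matrix (Fin r) (Fin n) F,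
      ∑ h : Matrix (Fin n) (Fin r) F with a * h = (1 : Matrix (Fin r) (Fin r) F), y h = 0 := by
    intro a
    rw [← map_zero φ, ← hx a, projectAlong_apply, map_sum, Finset.sum_comm]
    refine Finset.sum_congr rfl fun U _ => ?_
    rw [Finset.sum_comm]
    simp only [Finset.sum_ite_eq, Finset.mem_filter, Finset.mem_univ, true_and, ← Matrix.mul_assoc]
    by_cases hu : IsUnit (a * frameMatrix (f U))
    · obtain ⟨g, hg⟩ := hu
      rw [← hg, extendZero_unit, Finset.sum_eq_single g⁻¹]
      · simp
      · intro t _ ht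
        rw [if_neg]
        rw [← Units.val_mul, Units.val_eq_one]
        exact fun h => ht (eq_inv_of_mul_eq_one_right h)
      · simp
    · rw [extendZero_of_not_isUnit π hu, LinearMap.zero_apply, map_zero]
      refine Finset.sum_eq_zero fun t _ => if_neg fun h => hu ?_
      exact IsUnit.of_mul_eq_one _ h
  have h0 := eq_zero_of_sum_right_inverses hy (frameMatrix (f U₀))
    (by rw [Matrix.rank, range_frameMatrix, U₀.2])
  simp only [y] at h0
  rw [Finset.sum_eq_single U₀, Finset.sum_eq_single 1] at h0
  · simpa using h0
  · intro t _ ht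
    refine if_neg fun h => ht ?_
    obtain ⟨l, hl⟩ := exists_mul_frameMatrix_eq_one (f U₀)
    have := congrArg (fun w : Matrix (Fin n) (Fin r) F => l * w) h
    simp only [← Matrix.mul_assoc, hl, Matrix.one_mul] at this
    exact Units.ext this
  · simp
  · intro U _ hU
    refine Finset.sum_eq_zero fun t _ => if_neg fun h => hU ?_
    have hle : U₀.1 ≤ U.1 := by
      rw [← range_frameMatrix (f U₀), ← range_frameMatrix (f U), ← h, Matrix.mulVecLin_mul]
      exact LinearMap.range_comp_le_range _ _
    exact Subtype.ext (Submodule.eq_of_le_of_finrank_eq hle (U₀.2.trans U.2.symm)).symm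
  · simp

theorem transposeForm_injective [IsAlgClosed k] [CharZero k] [Finite F]
    (f : Frames F n r) (π : Representation k (GL (Fin r) F) V)
    {β : V →ₗ[k] Module.Dual k V} (hβ : Function.Injective β) :
    Function.Injective (transposeForm f π β) := by
  rw [injective_iff_map_eq_zero]
  intro x hx
  refine eq_zero_of_projectAlong_eq_zero f π fun l => ?_
  by_cases hl : l.rank = r
  -- The row space `W` of `l` gives `l = vᵗ f_Wᵗ`, so the operators for the `f_Wᵗ` control those for
  -- all `l`.
  · let W : Gr F n r := ⟨LinearMap.range l.transpose.mulVecLin,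
      l.rank_transpose.trans hl⟩
    obtain ⟨v, hv⟩ := exists_eq_mul_of_range_le (range_frameMatrix (f W)).ge
    have h0 : projectAlong f π (frameMatrix (f W)).transpose x = 0 := by
      refine hβ (LinearMap.ext fun w => ?_)
      rw [← transposeForm_single, hx, map_zero]
      rfl
    rw [← Matrix.transpose_transpose l, hv, Matrix.transpose_mul, projectAlong_mul, h0, map_zero]
  · rw [projectAlong_of_rank_ne f π hl, LinearMap.zero_apply]

end Form

/-! ### From the form to an isomorphism of `k[M_n]`-modules -/

instance {k F M : Type*} [Field k] [Field F] {n : ℕ} [AddCommGroup M] [Module k M]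
    [Module (Alg k F n) M] [IsScalarTower k (Alg k F n) M] :
    IsScalarTower k (Alg k F n) (TransposeDual k F n M) where
  smul_assoc c a φ := by
    refine LinearMap.ext fun v => ?_
    change TransposeDual.toDual k F n M φ ((transposeAnti k F n (c • a)).unop • v) =
      c • TransposeDual.toDual k F n M φ ((transposeAnti k F n a).unop • v)
    rw [map_smul (transposeAnti k F n), MulOpposite.unop_smul, smul_assoc,
      (TransposeDual.toDual k F n M φ).map_smul]

end MatrixMonoid

theorem proposition5p6 {k : Type*} [Field k] [IsAlgClosed k] [CharZero k]
    {F : Type*} [Field F] [Finite F] {n r : ℕ} (hr : r ≤ n)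
    {V : Type*} [AddCommGroup V] [Module k V]
    (π : Representation k (GL (Fin r) F) V) (hπ : π.IsIrreducible)
    (f : MatrixMonoid.Frames F n r) :
    Nonempty (MatrixMonoid.TransposeDual k F n (MatrixMonoid.L f π)
      ≃ₗ[MonoidAlgebra k (Matrix (Fin n) (Fin n) F)] MatrixMonoid.L f π) := by
  have : Fintype (MatrixMonoid.Gr F n r) := Fintype.ofFinite _
  have : FiniteDimensional k V := MatrixMonoid.finiteDimensional_of_isIrreducible π hπ
  obtain ⟨β, hβ, hadj⟩ := MatrixMonoid.exists_transpose_form π hπ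
  let Φ : MatrixMonoid.L f π →ₗ[k] MatrixMonoid.TransposeDual k F n (MatrixMonoid.L f π) :=
    MatrixMonoid.transposeForm f π β
  have hinj : Function.Injective Φ := MatrixMonoid.transposeForm_injective f π hβ
  -- `V` and the set of subspaces are finite-dimensional and finite respectively, so the dual has
  -- the same finite dimension.
  have hsurj : Function.Surjective Φ :=
    (LinearMap.injective_iff_surjective_of_finrank_eq_finrank
      (f := MatrixMonoid.transposeForm f π β) Subspace.dual_finrank_eq.symm).1 hinj
  refine ⟨(LinearEquiv.ofBijective (MonoidAlgebra.equivariantOfLinearOfComm Φ fun m x => ?_)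
    ⟨hinj, hsurj⟩).symm⟩
  refine LinearMap.ext fun y => ?_
  have hact : ∀ (a : Matrix (Fin n) (Fin n) F) (z : MatrixMonoid.L f π),
      (MonoidAlgebra.single a (1 : k) • z : MatrixMonoid.L f π) =
        MatrixMonoid.action f π a z := fun a z =>
    ((MatrixMonoid.simpleRep f π).asModuleEquiv_symm_map_rho a z).symm
  have htr : (MatrixMonoid.transposeAnti k F n (MonoidAlgebra.single m (1 : k))).unop =
      MonoidAlgebra.single m.transpose (1 : k) :=
    congrArg MulOpposite.unop (MatrixMonoid.transposeAnti_of k F n m)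
  change MatrixMonoid.transposeForm f π β (MonoidAlgebra.single m (1 : k) • x) y =
    MatrixMonoid.transposeForm f π β x
      ((MatrixMonoid.transposeAnti k F n (MonoidAlgebra.single m (1 : k))).unop • y)
  rw [htr, hact, hact]
  exact MatrixMonoid.transposeForm_action f π hadj m x y
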